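/- **Theorem 4.1 (all curvature invariants of a plane wave vanish).** Let $m\ge 0$ and let $g$ be a plane wave metric on $\mathbb R^{m+2}$ with coordinates $(u,v,x^1,\dots,x^m)$ (the classical, four-dimensional case being $m=2$). That is, $g$ satisfies one of the following two definitions. (a) $g = 2\,du\,dv + H(u,\mathbf x)\,du^2 + \sum_{i}(dx^i)^2$ with $H(u,\mathbf x)=\sum_{i,j=1}^{m} h_{ij}(u)\,x^i x^j$, where $h_{ij}=h_{ji}$ are smooth functions on $\mathbb R$. (b) $g = 2\,du\,dv + H(u,\mathbf x)\,du^2 + \sum_{i}(dx^i)^2$ with $H$ an arbitrary smooth function on $\mathbb R\times\mathbb R^m$, and there is a smooth, nowhere vanishing, null vector field $Z$ with $\nabla Z=0$ such that, with $Z_\perp=\{X : g(X,Z)=0\}$, the curvature satisfies $R(X,Y)=0$ for all $X,Y\in Z_\perp$ and $\nabla_X R=0$ for all $X\in Z_\perp$. Here $\nabla$ is the Levi-Civita connection of $g$ and $R$ its Riemann tensor. An *elementary scalar curvature invariant* of $g$ is a full contraction with the inverse metric of a tensor product $\nabla^{p_1}R\otimes\cdots\otimes\nabla^{p_r}R$,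 where $r\ge 1$, $p_1,\dots,p_r\ge 0$, $R=R_{\rho\sigma\mu\nu}$ is the covariant Riemann tensor, the total number of indices is even, the indices are arranged in any way into disjoint pairs, and each pair is contracted with $g^{\alpha\beta}$. A *scalar curvature invariant* of $g$ is a real polynomial without constant term in elementary ones. Then every scalar curvature invariant $J$ of $g$ vanishes identically: $J(x)=0$ for every $x\in\mathbb R^{m+2}$. -/

import Mathlib

open scoped ContDiff

noncomputable section

namespace PlaneWave

section Curvature

variable {ι : Type} [Fintype ι] [DecidableEq ι]

/-- A field of symmetric bilinear forms on the manifold `ι → ℝ`, given by its components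
`g x μ ν = g_{μν}(x)` in the standard coordinates. -/
abbrev MetricField (ι : Type) : Type := (ι → ℝ) → Matrix ι ι ℝ

/-- A covariant tensor field of rank `k` on `ι → ℝ`, given by its components:
`T idx x = T_{idx 0, …, idx (k-1)}(x)`. -/
abbrev TensorField (ι : Type) (k : ℕ) : Type := (Fin k → ι) → (ι → ℝ) → ℝ

/-- The partial derivative `∂_μ f`. -/
def pderiv (μ : ι) (f : (ι → ℝ) → ℝ) (x : ι → ℝ) : ℝ :=
  fderiv ℝ f x (Pi.single μ 1)

/-- The Christoffel symbols `Γ^ρ_{μν}` of the Levi-Civita connection of `g`. -/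
def christoffel (g : MetricField ι) (ρ μ ν : ι) (x : ι → ℝ) : ℝ :=
  (1 / 2) * ∑ σ, (g x)⁻¹ ρ σ *
    (pderiv μ (fun y => g y σ ν) x + pderiv ν (fun y => g y σ μ) x
      - pderiv σ (fun y => g y μ ν) x)

/-- The Riemann tensor `R^ρ_{σμν}`, the `ρ`-component of `R(∂_μ, ∂_ν) ∂_σ`. -/
def riemannUp (g : MetricField ι) (ρ σ μ ν : ι) (x : ι → ℝ) : ℝ :=
  pderiv μ (christoffel g ρ ν σ) x - pderiv ν (christoffel g ρ μ σ) x
    + ∑ l, (christoffel g ρ μ l x * christoffel g l ν σ x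
      - christoffel g ρ ν l x * christoffel g l μ σ x)

/-- The covariant Riemann tensor `R_{ρσμν} = g_{ρλ} R^λ_{σμν}`. -/
def riemann (g : MetricField ι) : TensorField ι 4 := fun idx x =>
  ∑ l, g x (idx 0) l * riemannUp g l (idx 1) (idx 2) (idx 3) x

/-- The covariant derivative of a covariant tensor field; the new index comes first:
`(∇T)_{μ ν₁ … ν_k} = ∂_μ T_{ν₁ … ν_k} - ∑_i Γ^l_{μ ν_i} T_{ν₁ … l … ν_k}`. -/
def covDeriv (g : MetricField ι) {k : ℕ} (T : TensorField ι k) : TensorField ι (k + 1) :=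
  fun idx x =>
    pderiv (idx 0) (T (Fin.tail idx)) x
      - ∑ i : Fin k, ∑ l : ι, christoffel g l (idx 0) (Fin.tail idx i) x
          * T (Function.update (Fin.tail idx) i l) x

/-- The `p`-th iterated covariant derivative `∇_{μ_p} … ∇_{μ_1} R_{ρσμν}`. -/
def nablaRiemann (g : MetricField ι) : (p : ℕ) → TensorField ι (4 + p)
  | 0 => riemann g
  | p + 1 => covDeriv g (nablaRiemann g p)

/-- The pattern of a full contraction of a product of covariant derivatives of the Riemann tensor:
there are `r ≥ 1` factors, the `j`-th factor is `∇^{order j} R`, with `4 + order j` index slots,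
and `pairing` arranges the set of all index slots of all factors into `N` disjoint pairs
(in particular the total number of slots is even). -/
structure ContractionPattern where
  r : ℕ
  r_pos : 0 < r
  order : Fin r → ℕ
  N : ℕ
  pairing : (Σ j : Fin r, Fin (4 + order j)) ≃ Fin N × Fin 2

/-- The elementary scalar curvature invariant with a given contraction pattern: in
`∇^{p₁}R ⊗ ⋯ ⊗ ∇^{p_r}R`, each pair of indices is contracted with the inverse metric. -/
def fullContraction (g : MetricField ι) (c : ContractionPattern) (x : ι → ℝ) : ℝ :=
  ∑ idx : (Σ j : Fin c.r, Fin (4 + c.order j)) → ι,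
    (∏ j : Fin c.r, nablaRiemann g (c.order j) (fun s => idx ⟨j, s⟩) x)
      * ∏ k : Fin c.N, (g x)⁻¹ (idx (c.pairing.symm (k, 0))) (idx (c.pairing.symm (k, 1)))

/-- A scalar curvature invariant of `g`: a real polynomial without constant term in the full
contractions of products of covariant derivatives of the Riemann tensor. -/
def IsScalarCurvatureInvariant (g : MetricField ι) (J : (ι → ℝ) → ℝ) : Prop :=
  J ∈ NonUnitalAlgebra.adjoin ℝ (Set.range (fullContraction g))

/-- The scalar product `g(X, Y)` at the point `x`. -/
def metricProd (g : MetricField ι) (x X Y : ι → ℝ) : ℝ :=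
  ∑ μ, ∑ ν, g x μ ν * X μ * Y ν

/-- `Z` is a covariantly constant null vector field: smooth, nontrivial (and, being parallel, hence
without zeros), null, and with `∇_μ Z^ν = ∂_μ Z^ν + Γ^ν_{μl} Z^l = 0`. -/
structure IsParallelNull (g : MetricField ι) (Z : (ι → ℝ) → ι → ℝ) : Prop where
  smooth : ContDiff ℝ ∞ Z
  ne_zero : ∀ x, Z x ≠ 0
  null : ∀ x, metricProd g x (Z x) (Z x) = 0
  parallel : ∀ x μ ν, pderiv μ (fun y => Z y ν) x + ∑ l, christoffel g ν μ l x * Z x l = 0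

/-- The wavefront is flat: `R` vanishes on `Z_⊥ ∧ Z_⊥`, that is, `R(X, Y) = 0` whenever `X` and `Y`
are orthogonal to `Z`. -/
def FlatWavefront (g : MetricField ι) (Z : (ι → ℝ) → ι → ℝ) : Prop :=
  ∀ x X Y : ι → ℝ, metricProd g x X (Z x) = 0 → metricProd g x Y (Z x) = 0 →
    ∀ ρ σ, ∑ μ, ∑ ν, X μ * Y ν * riemannUp g ρ σ μ ν x = 0

/-- `∇_X R = 0` for every `X` orthogonal to `Z`. -/
def CurvatureParallelAlong (g : MetricField ι) (Z : (ι → ℝ) → ι → ℝ) : Prop :=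
  ∀ x X : ι → ℝ, metricProd g x X (Z x) = 0 →
    ∀ idx : Fin 4 → ι, ∑ μ, X μ * covDeriv g (riemann g) (Fin.cons μ idx) x = 0

end Curvature

/-- The indices of the coordinates `(u, v, x¹, …, x^m)` of `ℝ^(m+2)`. -/
abbrev Coord (m : ℕ) : Type := Fin 2 ⊕ Fin m

/-- The metric `2 du dv + H(u, x¹, …, x^m) du² + (dx¹)² + ⋯ + (dx^m)²` on `ℝ^(m+2)`. -/
def ppMetric {m : ℕ} (H : ℝ → (Fin m → ℝ) → ℝ) : MetricField (Coord m) := fun p =>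
  Matrix.fromBlocks !![H (p (Sum.inl 0)) (fun i => p (Sum.inr i)), 1; 1, 0] 0 0 1

/-- The (Brinkmann) definition: `H` is a quadratic form in `x` with smooth `u`-dependent
coefficients. -/
def IsPlaneWave {m : ℕ} (g : MetricField (Coord m)) : Prop :=
  ∃ h : ℝ → Matrix (Fin m) (Fin m) ℝ,
    (∀ i j, ContDiff ℝ ∞ (fun u => h u i j)) ∧ (∀ u, (h u).IsSymm) ∧
    g = ppMetric (fun u x => ∑ i, ∑ j, h u i j * x i * x j)

/-- The covariant definition: a pp-wave, with smooth `H`, having a covariantly constant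
null vector field `Z` with flat wavefront for which `∇_X R = 0` for all `X` orthogonal to `Z`. -/
def IsCovariantPlaneWave {m : ℕ} (g : MetricField (Coord m)) : Prop :=
  (∃ H : ℝ → (Fin m → ℝ) → ℝ,
    ContDiff ℝ ∞ (fun q : ℝ × (Fin m → ℝ) => H q.1 q.2) ∧ g = ppMetric H) ∧
  ∃ Z : (Coord m → ℝ) → Coord m → ℝ,
    IsParallelNull g Z ∧ FlatWavefront g Z ∧ CurvatureParallelAlong g Z

end PlaneWave

end

/-!
Since `∂_v` is a parallel null Killing field, the nonzero components of every `∇^p R` have at least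
one index `u` and no index `v`. As `g^{uν} = 0` for `ν ≠ v`, a nonzero term of a full contraction
would have to pair its indices `u` with indices `v`, of which there are none.
-/

namespace PlaneWave

section Translation

variable {ι : Type} [DecidableEq ι]

theorem pderiv_zero (μ : ι) (x : ι → ℝ) : pderiv μ 0 x = 0 := by
  rw [pderiv, fderiv_zero, Pi.zero_apply, zero_apply]

/-- The function `f` does not depend on the coordinate `κ`, as invariance under the translations
along the `κ`-axis, so that no differentiability is involved. -/
def IndependentOf {α : Type*} (κ : ι) (f : (ι → ℝ) → α) : Prop :=
  ∀ (t : ℝ) (x : ι → ℝ), f (x + t • Pi.single κ 1) = f x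

namespace IndependentOf

variable {κ : ι}

theorem comp {α β : Type*} {f : (ι → ℝ) → α} (hf : IndependentOf κ f) (φ : α → β) :
    IndependentOf κ (fun x => φ (f x)) :=
  fun t x => congrArg φ (hf t x)

theorem pderiv_eq_zero [Finite ι] {f : (ι → ℝ) → ℝ} (hf : IndependentOf κ f) (x : ι → ℝ) :
    pderiv κ f x = 0 := by
  cases nonempty_fintype ι
  by_cases hd : DifferentiableAt ℝ f x
  · have h : lineDeriv ℝ f x (Pi.single κ 1) = 0 := by
      simp only [lineDeriv, hf _ x, deriv_const]
    rw [PlaneWave.pderiv, ← hd.lineDeriv_eq_fderiv, h]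
  · rw [PlaneWave.pderiv, fderiv_zero_of_not_differentiableAt hd, zero_apply]

theorem pderiv [Finite ι] {f : (ι → ℝ) → ℝ} (hf : IndependentOf κ f) (μ : ι) :
    IndependentOf κ (pderiv μ f) := by
  cases nonempty_fintype ι
  intro t x
  have h : (fun y => f (y + t • Pi.single κ 1)) = f := funext (hf t)
  rw [PlaneWave.pderiv, PlaneWave.pderiv, ← fderiv_comp_add_right, h]

variable [Fintype ι] {g : MetricField ι}

theorem christoffel (hg : IndependentOf κ g) (ρ μ ν : ι) :
    IndependentOf κ (christoffel g ρ μ ν) := by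
  intro t x
  have hdg (μ σ ν : ι) := (hg.comp fun A => A σ ν).pderiv μ t x
  simp only [PlaneWave.christoffel, hg t x, hdg]

theorem riemannUp (hg : IndependentOf κ g) (ρ σ μ ν : ι) :
    IndependentOf κ (riemannUp g ρ σ μ ν) := by
  intro t x
  simp only [PlaneWave.riemannUp, hg.christoffel _ _ _ t x, (hg.christoffel _ _ _).pderiv _ t x]

theorem riemann (hg : IndependentOf κ g) (idx : Fin 4 → ι) : IndependentOf κ (riemann g idx) := by
  intro t x
  simp only [PlaneWave.riemann, hg t x, hg.riemannUp _ _ _ _ t x]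

theorem covDeriv (hg : IndependentOf κ g) {k : ℕ} {T : TensorField ι k}
    (hT : ∀ idx, IndependentOf κ (T idx)) (idx : Fin (k + 1) → ι) :
    IndependentOf κ (covDeriv g T idx) := by
  intro t x
  simp only [PlaneWave.covDeriv, hg.christoffel _ _ _ t x, hT _ t x, (hT _).pderiv _ t x]

theorem nablaRiemann (hg : IndependentOf κ g) :
    ∀ (p : ℕ) (idx : Fin (4 + p) → ι), IndependentOf κ (nablaRiemann g p idx)
  | 0 => hg.riemann
  | p + 1 => hg.covDeriv (hg.nablaRiemann p)

end IndependentOf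

end Translation

theorem IsScalarCurvatureInvariant.eq_zero_of_fullContraction_eq_zero {ι : Type}
    [Fintype ι] [DecidableEq ι] {g : MetricField ι} {J : (ι → ℝ) → ℝ}
    (hJ : IsScalarCurvatureInvariant g J) (hg : ∀ c, fullContraction g c = 0) : J = 0 := by
  have h : NonUnitalAlgebra.adjoin ℝ (Set.range (fullContraction g)) ≤ ⊥ :=
    NonUnitalAlgebra.adjoin_le <| Set.range_subset_iff.mpr fun c =>
      NonUnitalAlgebra.mem_bot.mpr (hg c)
  exact NonUnitalAlgebra.mem_bot.mp (h hJ)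

section Components

variable {m : ℕ}

/-- The index of the coordinate `u`. -/
abbrev Coord.u : Coord m := Sum.inl 0

/-- The index of the coordinate `v`. -/
abbrev Coord.v : Coord m := Sum.inl 1

open Coord

variable (H : ℝ → (Fin m → ℝ) → ℝ)

theorem ppMetric_isSymm (x : Coord m → ℝ) : (ppMetric H x).IsSymm :=
  .fromBlocks (by ext i j; fin_cases i <;> fin_cases j <;> rfl) rfl Matrix.isSymm_one

theorem ppMetric_inv (x : Coord m → ℝ) :
    (ppMetric H x)⁻¹ =
      Matrix.fromBlocks !![0, 1; 1, -H (x u) (fun i => x (Sum.inr i))] 0 0 1 := by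
  apply Matrix.inv_eq_right_inv
  rw [ppMetric, Matrix.fromBlocks_multiply, ← Matrix.fromBlocks_one]
  congr 1 <;> simp [Matrix.one_fin_two]

theorem ppMetric_v_apply_eq_zero (x : Coord m → ℝ) {ν : Coord m} (hν : ν ≠ u) :
    ppMetric H x v ν = 0 := by
  rcases ν with ν | ν
  · fin_cases ν
    exacts [absurd rfl hν, rfl]
  · rfl

theorem ppMetric_inv_u_apply_eq_zero (x : Coord m → ℝ) {ν : Coord m} (hν : ν ≠ v) :
    (ppMetric H x)⁻¹ u ν = 0 := by
  rw [ppMetric_inv]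
  rcases ν with ν | ν
  · fin_cases ν
    exacts [rfl, absurd rfl hν]
  · rfl

theorem ppMetric_inv_apply_u_eq_zero (x : Coord m → ℝ) {μ : Coord m} (hμ : μ ≠ v) :
    (ppMetric H x)⁻¹ μ u = 0 := by
  rw [(ppMetric_isSymm H x).inv.apply, ppMetric_inv_u_apply_eq_zero H x hμ]

theorem independentOf_v_ppMetric : IndependentOf v (ppMetric H) := by
  intro t x
  simp [ppMetric]

theorem independentOf_ppMetric_apply (κ : Coord m) {μ ν : Coord m} (h : μ ≠ u ∨ ν ≠ u) :
    IndependentOf κ (fun x => ppMetric H x μ ν) := by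
  intro t x
  rcases μ with μ | μ <;> rcases ν with ν | ν
  · fin_cases μ <;> fin_cases ν
    · simp at h
    all_goals rfl
  all_goals rfl

theorem pderiv_ppMetric_eq_zero {κ μ ν : Coord m} (h : κ = v ∨ μ ≠ u ∨ ν ≠ u)
    (x : Coord m → ℝ) : pderiv κ (fun y => ppMetric H y μ ν) x = 0 := by
  rcases h with rfl | h
  · exact ((independentOf_v_ppMetric H).comp fun A => A μ ν).pderiv_eq_zero x
  · exact (independentOf_ppMetric_apply H κ h).pderiv_eq_zero x

theorem christoffel_up_u (μ ν : Coord m) : christoffel (ppMetric H) u μ ν = 0 := by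
  funext x
  refine mul_eq_zero_of_right _ (Finset.sum_eq_zero fun σ _ => ?_)
  by_cases hσ : σ = v
  · simp [hσ, pderiv_ppMetric_eq_zero]
  · rw [ppMetric_inv_u_apply_eq_zero H x hσ, zero_mul]

theorem christoffel_low_v (ρ : Coord m) {μ ν : Coord m} (h : μ = v ∨ ν = v) :
    christoffel (ppMetric H) ρ μ ν = 0 := by
  funext x
  rcases h with rfl | rfl <;> simp [christoffel, pderiv_ppMetric_eq_zero]

theorem christoffel_low_ne_u (ρ : Coord m) {μ ν : Coord m} (hμ : μ ≠ u) (hν : ν ≠ u) :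
    christoffel (ppMetric H) ρ μ ν = 0 := by
  funext x
  simp [christoffel, pderiv_ppMetric_eq_zero, hμ, hν]

theorem riemannUp_up_u (σ μ ν : Coord m) : riemannUp (ppMetric H) u σ μ ν = 0 := by
  funext x
  simp [riemannUp, christoffel_up_u, pderiv_zero]

theorem riemannUp_low_v (ρ : Coord m) {σ μ ν : Coord m} (h : σ = v ∨ μ = v ∨ ν = v) :
    riemannUp (ppMetric H) ρ σ μ ν = 0 := by
  have hv (μ ν : Coord m) : pderiv v (christoffel (ppMetric H) ρ μ ν) = 0 :=
    funext ((independentOf_v_ppMetric H).christoffel ρ μ ν).pderiv_eq_zero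
  funext x
  rcases h with rfl | rfl | rfl <;> simp [riemannUp, christoffel_low_v, pderiv_zero, hv]

theorem riemannUp_low_ne_u (ρ : Coord m) {σ μ ν : Coord m} (hσ : σ ≠ u) (hμ : μ ≠ u)
    (hν : ν ≠ u) : riemannUp (ppMetric H) ρ σ μ ν = 0 := by
  funext x
  simp [riemannUp, christoffel_low_ne_u, hσ, hμ, hν, pderiv_zero]

end Components

section NullAligned

open Coord

variable {m : ℕ} (H : ℝ → (Fin m → ℝ) → ℝ)

/-- Every nonzero component of the covariant tensor field `T` has at least one index `u` and no
index `v`: the algebraic type shared by all `∇^p R` of a pp-wave. -/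
structure IsNullAligned {k : ℕ} (T : TensorField (Coord m) k) : Prop where
  eq_zero_of_v : ∀ idx s, idx s = v → T idx = 0
  eq_zero_of_no_u : ∀ idx, (∀ s, idx s ≠ u) → T idx = 0

theorem isNullAligned_riemann : IsNullAligned (riemann (ppMetric H)) where
  eq_zero_of_v idx s hs := by
    funext x
    refine Finset.sum_eq_zero fun l _ => ?_
    by_cases h : idx 0 = v ∧ l ≠ u
    · rw [h.1, ppMetric_v_apply_eq_zero H x h.2, zero_mul]
    · suffices hR : riemannUp (ppMetric H) l (idx 1) (idx 2) (idx 3) = 0 by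
        rw [hR, Pi.zero_apply, mul_zero]
      fin_cases s
      · obtain rfl : l = u := by_contra fun hl => h ⟨hs, hl⟩
        exact riemannUp_up_u H _ _ _
      · exact riemannUp_low_v H l (.inl hs)
      · exact riemannUp_low_v H l (.inr (.inl hs))
      · exact riemannUp_low_v H l (.inr (.inr hs))
  eq_zero_of_no_u idx h := by
    funext x
    simp only [riemann, riemannUp_low_ne_u H _ (h 1) (h 2) (h 3), Pi.zero_apply, mul_zero,
      Finset.sum_const_zero]

theorem IsNullAligned.covDeriv {k : ℕ} {T : TensorField (Coord m) k} (hT : IsNullAligned T)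
    (hTv : ∀ idx, IndependentOf v (T idx)) : IsNullAligned (covDeriv (ppMetric H) T) where
  eq_zero_of_v idx s hs := by
    funext x
    have hdT : pderiv (idx 0) (T (Fin.tail idx)) x = 0 := by
      cases s using Fin.cases with
      | zero => rw [hs, (hTv _).pderiv_eq_zero]
      | succ j => rw [hT.eq_zero_of_v (Fin.tail idx) j hs, pderiv_zero]
    simp only [PlaneWave.covDeriv, hdT, zero_sub, Pi.zero_apply, neg_eq_zero]
    refine Finset.sum_eq_zero fun i _ => Finset.sum_eq_zero fun l _ => ?_
    by_cases h : idx 0 = v ∨ Fin.tail idx i = v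
    · rw [christoffel_low_v H l h, Pi.zero_apply, zero_mul]
    · push Not at h
      obtain ⟨j, rfl⟩ := Fin.exists_succ_eq.mpr fun h0 : s = 0 => h.1 (h0 ▸ hs)
      have hji : j ≠ i := fun hji => h.2 (hji ▸ hs)
      have hj : Function.update (Fin.tail idx) i l j = v := by
        rw [Function.update_of_ne hji]
        exact hs
      rw [hT.eq_zero_of_v _ j hj, Pi.zero_apply, mul_zero]
  eq_zero_of_no_u idx h := by
    have hu (s : Fin k) : Fin.tail idx s ≠ u := h s.succ
    funext x
    simp only [PlaneWave.covDeriv, hT.eq_zero_of_no_u _ hu, pderiv_zero,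
      christoffel_low_ne_u H _ (h 0) (hu _), Pi.zero_apply, zero_mul, Finset.sum_const_zero,
      sub_zero]

theorem isNullAligned_nablaRiemann : ∀ p : ℕ, IsNullAligned (nablaRiemann (ppMetric H) p)
  | 0 => isNullAligned_riemann H
  | p + 1 =>
    (isNullAligned_nablaRiemann p).covDeriv H ((independentOf_v_ppMetric H).nablaRiemann p)

theorem fullContraction_ppMetric_eq_zero (c : ContractionPattern) :
    fullContraction (ppMetric H) c = 0 := by
  funext x
  refine Finset.sum_eq_zero fun idx _ => ?_
  by_contra hne
  obtain ⟨hR, hg⟩ := mul_ne_zero_iff.mp hne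
  rw [Finset.prod_ne_zero_iff] at hR hg
  have aligned (j : Fin c.r) := isNullAligned_nablaRiemann H (c.order j)
  have hv (a) : idx a ≠ v := fun ha =>
    hR a.1 (Finset.mem_univ _) (congrFun ((aligned a.1).eq_zero_of_v _ a.2 ha) x)
  have hu (a) : idx a ≠ u := by
    intro ha
    obtain ⟨⟨k, e⟩, rfl⟩ := c.pairing.symm.surjective a
    refine hg k (Finset.mem_univ _) ?_
    fin_cases e
    · exact ha ▸ ppMetric_inv_u_apply_eq_zero H x (hv _)
    · exact ha ▸ ppMetric_inv_apply_u_eq_zero H x (hv _)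
  exact hR ⟨0, c.r_pos⟩ (Finset.mem_univ _)
    (congrFun ((aligned _).eq_zero_of_no_u _ fun _ => hu _) x)

end NullAligned

section PPWave

variable {m : ℕ}

/-- A pp-wave in Brinkmann form, with smooth profile `H`. -/
def IsPPWave (g : MetricField (Coord m)) : Prop :=
  ∃ H : ℝ → (Fin m → ℝ) → ℝ,
    ContDiff ℝ ∞ (fun q : ℝ × (Fin m → ℝ) => H q.1 q.2) ∧ g = ppMetric H

variable {g : MetricField (Coord m)}

theorem IsPlaneWave.isPPWave (hg : IsPlaneWave g) : IsPPWave g := by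
  obtain ⟨h, h_smooth, -, rfl⟩ := hg
  refine ⟨_, ?_, rfl⟩
  refine ContDiff.sum fun i _ => ContDiff.sum fun j _ => ?_
  exact (((h_smooth i j).comp contDiff_fst).mul (by fun_prop)).mul (by fun_prop)

theorem IsCovariantPlaneWave.isPPWave (hg : IsCovariantPlaneWave g) : IsPPWave g :=
  hg.1

end PPWave

end PlaneWave

theorem theorem4p1_general {m : ℕ} {g : PlaneWave.MetricField (PlaneWave.Coord m)}
    (hg : PlaneWave.IsPPWave g) {J : (PlaneWave.Coord m → ℝ) → ℝ}
    (hJ : PlaneWave.IsScalarCurvatureInvariant g J) (x : PlaneWave.Coord m → ℝ) : J x = 0 := by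
  obtain ⟨H, -, rfl⟩ := hg
  exact congrFun
    (hJ.eq_zero_of_fullContraction_eq_zero (PlaneWave.fullContraction_ppMetric_eq_zero H)) x

theorem theorem4p1 (m : ℕ) (g : PlaneWave.MetricField (PlaneWave.Coord m))
    (hg : PlaneWave.IsPlaneWave g ∨ PlaneWave.IsCovariantPlaneWave g)
    (J : (PlaneWave.Coord m → ℝ) → ℝ) (hJ : PlaneWave.IsScalarCurvatureInvariant g J) :
    ∀ x, J x = 0 :=
  theorem4p1_general (hg.elim (·.isPPWave) (·.isPPWave)) hJ
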